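/- Let $\mathcal O_K$ be a principal ideal domain with field of fractions $K$, and let $L/K$ be a finite Galois extension whose Galois group is a semidirect product $G=J\rtimes G'$ ($J$ normal in $G$, $G'$ a complement of $J$). Put $E=L^{G'}$ and $F=L^{J}$, and for $M\in\{E,F,L\}$ let $\mathcal O_M$ be the integral closure of $\mathcal O_K$ in $M$. If $M/K$ is Hopf Galois with Hopf algebra $A$ acting on $M$, the associated order is $$\mathfrak A_A=\{h\in A \mid h\cdot x\in\mathcal O_M \text{ for all } x\in\mathcal O_M\}.$$ Let $N_1\le\mathrm{Perm}(J)$ and $N_2\le\mathrm{Perm}(G')$ be regular subgroups normalized by the left translation actions of $G$ on $J\cong G/G'$ and on $G'\cong G/J$ respectively. Let $H_1=L[N_1]^G$ and $\overline H=L[N_2]^G=F[N_2]^{G/J}$ be the Hopf algebras of the corresponding Hopf Galois structures of $E/K$ and $F/K$, and let $H=L[N]^G$ be the Hopf algebra of the induced Hopf Galois structure of $L/K$, given by $N=\iota(N_1\times N_2)\le\mathrm{Perm}(G)$, where $\iota(\varphi,\psi)(\sigma\tau)=\varphi(\sigma)\psi(\tau)$ for $\sigma\in J$, $\tau\in G'$.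 (Here $G$ acts on $L$ by the Galois action and on the groups $N_1,N_2,N$ by conjugation by left translations, and the Hopf actions are $(\sum c_n n)\cdot x=\sum c_n\, n^{-1}(1)(x)$.) Identify $H=H_1\otimes_K\overline H$ by means of the isomorphism of $K$-algebras under which $(w\otimes\eta)\cdot(\alpha z)=(w\cdot\alpha)(\eta\cdot z)$ for $w\in H_1$, $\eta\in\overline H$, $\alpha\in E$, $z\in F$. Assume that $E/K$ and $F/K$ are arithmetically disjoint, i.e. $\mathcal O_{EF}=\mathcal O_E\otimes_{\mathcal O_K}\mathcal O_F$ via multiplication. Then: 1. $\mathfrak A_H=\mathfrak A_{H_1}\otimes_{\mathcal O_K}\mathfrak A_{\overline H}$, that is, the canonical map $\mathfrak A_{H_1}\otimes_{\mathcal O_K}\mathfrak A_{\overline H}\to H_1\otimes_K\overline H=H$ is an isomorphism of $\mathcal O_K$-algebras onto $\mathfrak A_H$. 2. If $\mathcal O_E$ is a free $\mathfrak A_{H_1}$-module and $\mathcal O_F$ is a free $\mathfrak A_{\overline H}$-module, then $\mathcal O_L$ is a free $\mathfrak A_H$-module. Moreover, if $\gamma$ is a free generator of $\mathcal O_E$ over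 $\mathfrak A_{H_1}$ and $\delta$ is a free generator of $\mathcal O_F$ over $\mathfrak A_{\overline H}$, then $\gamma\delta$ is a free generator of $\mathcal O_L$ over $\mathfrak A_H$. -/

import Mathlib

open scoped TensorProduct

section HopfGalois

/-- The map `j : L ⊗ H → End_K(L)`, `j (l ⊗ h) (x) = l * (h • x)`, attached to a `K`-linear action
of a `K`-algebra `H` on `L`. -/
noncomputable def hopfGaloisMap (K H L : Type*) [Field K] [Field L] [Algebra K L]
    [Ring H] [Algebra K H] [Module H L] [IsScalarTower K H L] :
    L ⊗[K] H →ₗ[K] Module.End K L :=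
  TensorProduct.lift
    ((LinearMap.mul K (Module.End K L)).compl₁₂
      (Algebra.lmul K L).toLinearMap
      (Algebra.lsmul K K L : H →ₐ[K] Module.End K L).toLinearMap)

/-- `L/K` is `H`-Galois: the Hopf algebra `H` acts `K`-linearly on `L`, the action makes `L` an
`H`-module algebra, and `j : L ⊗ H → End_K(L)` is bijective. -/
structure IsHopfGalois (K H L : Type*) [Field K] [Field L] [Algebra K L]
    [Ring H] [HopfAlgebra K H] [Module H L] [IsScalarTower K H L] : Prop where
  /-- `h • 1 = ε(h)`. -/
  smul_one : ∀ h : H, h • (1 : L) = algebraMap K L (Coalgebra.counit h)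
  /-- `h • (x y) = ∑ (h₁ • x) (h₂ • y)`, where `Δ(h) = ∑ h₁ ⊗ h₂`. -/
  smul_mul : ∀ (h : H) (x y : L), h • (x * y) =
    LinearMap.mul' K L
      (TensorProduct.map ((LinearMap.toSpanSingleton H L x).restrictScalars K)
        ((LinearMap.toSpanSingleton H L y).restrictScalars K)
        (Coalgebra.comul (R := K) h))
  bijective : Function.Bijective (hopfGaloisMap K H L)

end HopfGalois

section AssociatedOrder

variable (O K H L : Type*) [CommRing O] [Field K] [Algebra O K] [Field L] [Algebra K L]
  [Algebra O L] [IsScalarTower O K L] [Ring H] [Algebra K H] [Algebra O H] [IsScalarTower O K H]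
  [Module H L] [IsScalarTower K H L]

/-- The associated order `{h ∈ H | h • x ∈ 𝒪_L for all x ∈ 𝒪_L}`, where `𝒪_L` is the integral
closure of `O` in `L`. -/
def associatedOrder : Subalgebra O H where
  carrier := {h | ∀ x ∈ integralClosure O L, h • x ∈ integralClosure O L}
  mul_mem' := by
    intro a b ha hb x hx
    rw [mul_smul]
    exact ha _ (hb x hx)
  add_mem' := by
    intro a b ha hb x hx
    rw [add_smul]
    exact add_mem (ha x hx) (hb x hx)
  algebraMap_mem' := by
    intro r x hx
    rw [IsScalarTower.algebraMap_apply O K H, algebraMap_smul, algebraMap_smul]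
    exact Subalgebra.smul_mem _ hx r

/-- `𝒪_L` is a module over the associated order, via the action of `H` on `L`. -/
instance associatedOrder.instModule :
    Module (associatedOrder O K H L) (integralClosure O L) where
  smul a x := ⟨(a : H) • (x : L), a.2 x x.2⟩
  one_smul x := Subtype.ext (one_smul H (x : L))
  mul_smul a b x := Subtype.ext (mul_smul (a : H) (b : H) (x : L))
  smul_zero a := Subtype.ext (smul_zero (a : H))
  smul_add a x y := Subtype.ext (smul_add (a : H) (x : L) (y : L))
  add_smul a b x := Subtype.ext (add_smul (a : H) (b : H) (x : L))
  zero_smul x := Subtype.ext (zero_smul H (x : L))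

end AssociatedOrder

/-- `m` is a free generator of the `A`-module `M`: every element of `M` is `a • m` for exactly one
`a : A`. -/
def IsFreeGenerator (A : Type*) {M : Type*} [Ring A] [AddCommGroup M] [Module A M] (m : M) : Prop :=
  Function.Bijective fun a : A => a • m

section ArithmeticDisjointness

variable (O : Type*) {K L : Type*} [CommRing O] [Field K] [Algebra O K] [Field L] [Algebra K L]
  [Algebra O L] [IsScalarTower O K L] (E F : IntermediateField K L)

/-- The inclusion `𝒪_E → L`. -/
noncomputable def integersVal : integralClosure O E →ₐ[O] L :=
  (E.val.restrictScalars O).comp (integralClosure O E).val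

/-- `E/K` and `F/K` are arithmetically disjoint: `𝒪_{EF} = 𝒪_E ⊗ 𝒪_F`, that is, multiplication
`𝒪_E ⊗ 𝒪_F → L` is injective and its image consists of the elements of `EF` integral over `O`. -/
def ArithmeticallyDisjoint : Prop :=
  Function.Injective (Algebra.TensorProduct.productMap (integersVal O E) (integersVal O F)) ∧
  ∀ x : L, x ∈ (Algebra.TensorProduct.productMap (integersVal O E) (integersVal O F)).range ↔
    x ∈ E ⊔ F ∧ IsIntegral O x

variable {O E F} in
/-- The product `γδ ∈ 𝒪_L` of `γ ∈ 𝒪_E` and `δ ∈ 𝒪_F`. -/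
noncomputable def integersMul (γ : integralClosure O E) (δ : integralClosure O F) :
    integralClosure O L :=
  ⟨((γ : E) : L) * ((δ : F) : L),
    mul_mem (IsIntegral.map (E.val.restrictScalars O) γ.2)
      (IsIntegral.map (F.val.restrictScalars O) δ.2)⟩

end ArithmeticDisjointness

section GreitherPareigis

/-- A regular (simply transitive) group of permutations. -/
def IsRegularPermGroup {X : Type*} (N : Subgroup (Equiv.Perm X)) : Prop :=
  ∀ x y : X, ∃! n : Equiv.Perm X, n ∈ N ∧ n x = y

/-- `N` is normalized by the permutations `Λ g`. -/
def IsNormalizedBy {Γ X : Type*} (Λ : Γ → Equiv.Perm X) (N : Subgroup (Equiv.Perm X)) : Prop :=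
  ∀ g : Γ, ∀ n : Equiv.Perm X, n ∈ N ↔ Λ g * n * (Λ g)⁻¹ ∈ N

/-- Greither–Pareigis description of a Hopf Galois structure. Let `G = Gal(L/K)`, let `M` be an
intermediate field of `L/K` and let `X` be a transversal in `G` of the subgroup `Gal(L/M)`
containing the identity: `rep : X → G` is the inclusion, `x₀ : X` is the point with `rep x₀ = 1`,
and `Λ : G → Perm X` is the left translation action of `G` on `X ≃ G/Gal(L/M)`.

For `N ≤ Perm X`, the statement says that the Hopf algebra `H` acting on `M` is `L[N]^G`, where `G`
acts on `L` by the Galois action and on `N` by conjugation through `Λ`, with the action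
`(∑ cₙ n) • x = ∑ cₙ n⁻¹(x₀)(x)` on `M`. The group algebra `L[N]` is the set of elements of
`L[Perm X]` supported on `N`. The Hopf algebra structure of `H` is the one
inherited from the group algebra: `Ψ : L ⊗ H → L[N]`, which identifies `H = 1 ⊗ H` with `L[N]^G`,
is a homomorphism of `L`-bialgebras. -/
def IsGreitherPareigis {K L X : Type*} [Field K] [Field L] [Algebra K L]
    (Λ : (L ≃ₐ[K] L) → Equiv.Perm X) (rep : X → (L ≃ₐ[K] L)) (x₀ : X)
    (N : Subgroup (Equiv.Perm X))
    (H M : Type*) [Ring H] [HopfAlgebra K H] [Field M] [Algebra M L] [Module H M] : Prop :=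
  ∃ Ψ : (L ⊗[K] H) →ₐc[L] MonoidAlgebra L (Equiv.Perm X),
    (Function.Injective fun h : H => Ψ (1 ⊗ₜ[K] h)) ∧
    (∀ f : MonoidAlgebra L (Equiv.Perm X),
      (∃ h : H, Ψ (1 ⊗ₜ[K] h) = f) ↔
        (∀ n : Equiv.Perm X, f.coeff n ≠ 0 → n ∈ N) ∧
        ∀ (g : L ≃ₐ[K] L) (n : Equiv.Perm X), f.coeff (Λ g * n * (Λ g)⁻¹) = g (f.coeff n)) ∧
    ∀ (h : H) (x : M), algebraMap M L (h • x) =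
      (Ψ (1 ⊗ₜ[K] h)).coeff.sum fun n c => c * rep (n⁻¹ x₀) (algebraMap M L x)

end GreitherPareigis

section Induction

variable {G : Type*} [Group G] {J G' : Subgroup G}

/-- For `G = J ⋊ G'`, the action of `G` on `J ≃ G/G'` by left translation of cosets:
`στ` sends `s` to `σ (τ s τ⁻¹)`, for `σ, s ∈ J` and `τ ∈ G'`. -/
noncomputable def lambdaJ [J.Normal] (hc : Subgroup.IsComplement' J G') (g : G) : Equiv.Perm J :=
  (MulAut.conjNormal ((hc.equiv g).2 : G) : J ≃* J).toEquiv.trans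
    (Equiv.mulLeft ((hc.equiv g).1 : J))

/-- For `G = J ⋊ G'`, the action of `G` on `G' ≃ G/J` by left translation of cosets:
`στ` sends `t` to `τ t`, for `σ ∈ J` and `τ, t ∈ G'`. -/
noncomputable def lambdaG' (hc : Subgroup.IsComplement' J G') (g : G) : Equiv.Perm G' :=
  Equiv.mulLeft ((hc.equiv g).2 : G')

/-- The subgroup `ι(N₁ × N₂)` of `Perm G`, where `G = J G'` and `ι(φ, ψ)(στ) = φ(σ) ψ(τ)` for
`σ ∈ J`, `τ ∈ G'`. -/
def inducedSubgroup (N₁ : Subgroup (Equiv.Perm J)) (N₂ : Subgroup (Equiv.Perm G')) :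
    Subgroup (Equiv.Perm G) where
  carrier := {n | ∃ φ ∈ N₁, ∃ ψ ∈ N₂, ∀ (σ : J) (τ : G'), n ((σ : G) * τ) = (φ σ : G) * ψ τ}
  mul_mem' := by
    rintro a b ⟨φ, hφ, ψ, hψ, h⟩ ⟨φ', hφ', ψ', hψ', h'⟩
    refine ⟨φ * φ', mul_mem hφ hφ', ψ * ψ', mul_mem hψ hψ', fun σ τ => ?_⟩
    rw [Equiv.Perm.mul_apply, h', h]
    rfl
  one_mem' := ⟨1, one_mem _, 1, one_mem _, fun _ _ => rfl⟩
  inv_mem' := by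
    rintro a ⟨φ, hφ, ψ, hψ, h⟩
    refine ⟨φ⁻¹, inv_mem hφ, ψ⁻¹, inv_mem hψ, fun σ τ => ?_⟩
    rw [Equiv.Perm.inv_eq_iff_eq, h]
    simp

end Induction

/-! Since `J ∩ G' = 1` and `|J| |G'| = [L:K]`, multiplication identifies `E ⊗ F` with `L`, so `w ⊗
η` becomes an operator on `L`. If `w` and `η` have coefficients `f₁` on `N₁` and `f₂` on `N₂`, the
products `f₁(φ) f₂(ψ)`, placed at `ι(φ, ψ)`, are `G`-equivariant and define an element of `H` acting
as that operator (`exists_smul_mul_eq`). All three actions are faithful and the dimensions agree,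
hence `H₁ ⊗ Hb ≃ H` (`exists_tensorProduct_algEquiv`).

Elements of `𝔄_{H₁} ⊗ 𝔄_{Hb}` preserve `𝒪_E ⊗ 𝒪_F = 𝒪_L`. For the converse
(`mem_range_associatedOrderTensorMap`), take `O`-bases `eᵢ` of `𝒪_E` and `bⱼ` of `𝔄_{Hb}`, and write
`h = ∑ uⱼ ⊗ bⱼ`. For `x ∈ 𝒪_E`, let `cᵢⱼ` be the coordinates of `uⱼ • x`; then `h • (xy) = ∑ eᵢ (vᵢ
• y)` with `vᵢ = ∑ⱼ cᵢⱼ bⱼ`. Integrality forces `vᵢ • y ∈ 𝒪_F` for all `y ∈ 𝒪_F`, so `vᵢ ∈ 𝔄_{Hb}`,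
so `cᵢⱼ ∈ O`, so `uⱼ • x ∈ 𝒪_E`.

For freeness, the isomorphisms `a ↦ aγ` and `b ↦ bδ` are tensored over `O`; a rank count shows that
a free `𝒪_M` has a single generator. -/

/-! ### Faithfulness of the Hopf action and the dimension of the Hopf algebra. -/

section HopfGaloisDimension

variable {K H L : Type*} [Field K] [Field L] [Algebra K L] [Ring H] [HopfAlgebra K H]
  [Module H L] [IsScalarTower K H L]

/-- The operator of `h` is `j (1 ⊗ h)`, and `h ↦ 1 ⊗ h` is injective over a field. -/
theorem IsHopfGalois.lsmul_injective (h : IsHopfGalois K H L) :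
    Function.Injective (Algebra.lsmul K K L : H →ₐ[K] Module.End K L) := by
  have h1 : Function.Injective fun x : H => (1 : L) ⊗ₜ[K] x :=
    Algebra.TensorProduct.includeRight_injective (algebraMap K L).injective
  intro a b hab
  refine h1 (h.bijective.1 ?_)
  simp [hopfGaloisMap, hab]

theorem IsHopfGalois.finiteDimensional [FiniteDimensional K L] (h : IsHopfGalois K H L) :
    FiniteDimensional K H :=
  Module.Finite.of_injective (Algebra.lsmul K K L : H →ₐ[K] Module.End K L).toLinearMap
    h.lsmul_injective

theorem IsHopfGalois.finrank_eq [FiniteDimensional K L] (h : IsHopfGalois K H L) :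
    Module.finrank K H = Module.finrank K L := by
  have h1 := (LinearEquiv.ofBijective _ h.bijective).finrank_eq
  rw [Module.finrank_tensorProduct, Module.finrank_linearMap] at h1
  exact Nat.eq_of_mul_eq_mul_left Module.finrank_pos h1

end HopfGaloisDimension

/-- The scalar `r` acts through its image in `K`, which is central in `H`. -/
theorem smul_smul_comm_of_tower {O H L : Type*} (K : Type*) [CommRing O] [Field K] [Algebra O K]
    [Field L] [Algebra K L] [Algebra O L] [IsScalarTower O K L] [Ring H] [Algebra K H]
    [Module H L] [IsScalarTower K H L] (r : O) (h : H) (x : L) : h • r • x = r • h • x := by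
  rw [← algebraMap_smul K r x, ← algebraMap_smul H (algebraMap O K r) x, ← mul_smul,
    ← Algebra.commutes, mul_smul, algebraMap_smul, algebraMap_smul]

/-! ### Rings of integers and associated orders as `O`-lattices. -/

section Lattices

open nonZeroDivisors

variable (O K : Type*) [CommRing O] [IsDomain O] [Field K] [Algebra O K] [IsFractionRing O K]

/-- A submodule of a `K`-vector space that spans it over `K = Frac O` is a localization map. -/
theorem isLocalizedModule_of_injective {M V : Type*} [AddCommGroup M] [Module O M]
    [AddCommGroup V] [Module O V] [Module K V] [IsScalarTower O K V] (f : M →ₗ[O] V)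
    (hf : Function.Injective f) (hs : ∀ v : V, ∃ d ∈ O⁰, ∃ m, d • v = f m) :
    IsLocalizedModule O⁰ f := by
  refine (isLocalizedModule_iff _ _).2 ⟨fun x => ?_, fun v => ?_, fun h => ⟨1, by rw [hf h]⟩⟩
  · have h0 : algebraMap O K x ≠ 0 := IsFractionRing.to_map_ne_zero_of_mem_nonZeroDivisors x.2
    rw [Module.End.isUnit_iff]
    have : (⇑((algebraMap O (Module.End O V)) (x : O))) =
        fun v : V => (algebraMap O K x) • v := by
      ext v; simp [Module.algebraMap_end_apply]
    rw [this]
    exact (MulAction.bijective (Units.mk0 _ h0))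
  · obtain ⟨d, hd, m, h⟩ := hs v
    exact ⟨(m, ⟨d, hd⟩), h⟩

variable (H L : Type*) [Field L] [Algebra K L] [Algebra O L] [IsScalarTower O K L]

/-- Used to turn `O`-bases of `𝒪_L` into `K`-bases of `L`: every element of `L` has a nonzero
integral `O`-multiple. -/
theorem integralClosure.isLocalizedModule_val [FiniteDimensional K L] :
    IsLocalizedModule O⁰ (integralClosure O L).val.toLinearMap := by
  refine isLocalizedModule_of_injective O K _ Subtype.val_injective fun v => ?_
  obtain ⟨d, hd, h⟩ := exists_integral_multiples O K (L := L) {v}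
  exact ⟨d, mem_nonZeroDivisors_of_ne_zero hd, ⟨d • v, h v (by simp)⟩, rfl⟩

theorem integralClosure.finite_of_isSeparable [IsPrincipalIdealRing O] [FiniteDimensional K L]
    [Algebra.IsSeparable K L] : Module.Finite O (integralClosure O L) :=
  IsIntegralClosure.finite O K L _

theorem integralClosure.free_of_isSeparable [IsPrincipalIdealRing O] [FiniteDimensional K L]
    [Algebra.IsSeparable K L] : Module.Free O (integralClosure O L) :=
  have : Module.IsTorsionFree O L := Module.IsTorsionFree.trans_faithfulSMul O K L
  IsIntegralClosure.module_free O K L _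

variable [Ring H] [Algebra K H] [Algebra O H] [IsScalarTower O K H]
  [Module H L] [IsScalarTower K H L]

instance associatedOrder.instIsScalarTower :
    IsScalarTower O (associatedOrder O K H L) (integralClosure O L) where
  smul_assoc r a x := Subtype.ext <| by
    change (r • (a : H)) • (x : L) = r • ((a : H) • (x : L))
    rw [← algebraMap_smul K r (a : H), smul_assoc, algebraMap_smul]

variable [FiniteDimensional K L] [Algebra.IsSeparable K L] [IsPrincipalIdealRing O]

/-- A common denominator `d` for the images under `h` of finitely many generators of `𝒪_L` gives `d
• h ∈ 𝔄`. -/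
theorem associatedOrder.isLocalizedModule_val :
    IsLocalizedModule O⁰ (associatedOrder O K H L).val.toLinearMap := by
  refine isLocalizedModule_of_injective O K _ Subtype.val_injective fun h => ?_
  classical
  obtain ⟨s, hs⟩ := (integralClosure.finite_of_isSeparable O K L).fg_top
  obtain ⟨d, hd, hds⟩ := exists_integral_multiples O K (L := L) (s.image fun x : integralClosure O L => h • (x : L))
  refine ⟨d, mem_nonZeroDivisors_of_ne_zero hd, ⟨d • h, fun x hx => ?_⟩, rfl⟩
  have hx' : (⟨x, hx⟩ : integralClosure O L) ∈ Submodule.span O (s : Set (integralClosure O L)) :=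
    hs ▸ Submodule.mem_top
  have key : ∀ y : integralClosure O L, y ∈ Submodule.span O (s : Set (integralClosure O L)) →
      (d • h) • (y : L) ∈ integralClosure O L := by
    intro y hy
    induction hy using Submodule.span_induction with
    | mem y hy =>
      rw [← algebraMap_smul K d h, smul_assoc, algebraMap_smul]
      exact hds _ (Finset.mem_image.2 ⟨y, hy, rfl⟩)
    | zero => simp
    | add y z _ _ hy hz => simpa [smul_add] using add_mem hy hz
    | smul r y _ hy =>
      have : (d • h) • (r • (y : L)) = r • (d • h) • (y : L) := smul_smul_comm_of_tower K _ _ _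
      simpa [this] using Subalgebra.smul_mem _ hy r
  exact key _ hx'

variable {O K H L} in
-- The associated order embeds in `End_O(𝒪_L)`, a finite module over a Noetherian ring; the
-- embedding is faithful because `𝒪_L` spans `L` over `K`.
theorem associatedOrder.finite_of_injective
    (hinj : Function.Injective (Algebra.lsmul K K L : H →ₐ[K] Module.End K L)) :
    Module.Finite O (associatedOrder O K H L) := by
  have := integralClosure.finite_of_isSeparable O K L
  have := integralClosure.free_of_isSeparable O K L
  have hloc := integralClosure.isLocalizedModule_val O K L
  refine Module.Finite.of_injective
    (Algebra.lsmul O O (integralClosure O L) :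
      associatedOrder O K H L →ₐ[O] Module.End O (integralClosure O L)).toLinearMap ?_
  intro a b hab
  refine Subtype.ext (hinj (LinearMap.ext fun v => ?_))
  obtain ⟨⟨x, d⟩, hx⟩ := hloc.surj v
  have h1 := congrArg Subtype.val (LinearMap.congr_fun hab x)
  have h2 : (a : H) • (x : L) = (b : H) • (x : L) := h1
  have h3 : (x : L) = (d : O) • v := hx.symm
  rw [h3, smul_smul_comm_of_tower K, smul_smul_comm_of_tower K] at h2
  have h0 : algebraMap O K d ≠ 0 := IsFractionRing.to_map_ne_zero_of_mem_nonZeroDivisors d.2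
  rw [← algebraMap_smul K, ← algebraMap_smul K (d : O) ((b : H) • v)] at h2
  exact smul_right_injective L h0 h2

variable {O K H L} in
theorem associatedOrder.free_of_injective
    (hinj : Function.Injective (Algebra.lsmul K K L : H →ₐ[K] Module.End K L)) :
    Module.Free O (associatedOrder O K H L) := by
  have := associatedOrder.finite_of_injective (O := O) hinj
  have : Module.IsTorsionFree O H := Module.IsTorsionFree.trans_faithfulSMul O K H
  have : Module.IsTorsionFree O (associatedOrder O K H L) :=
    Subtype.val_injective.moduleIsTorsionFree _ fun _ _ => rfl
  exact Module.free_of_finite_type_torsion_free'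

/-- If `𝒪_L` is free over the associated order, it has a free generator, by comparing ranks
over `O`. -/
theorem associatedOrder.exists_isFreeGenerator
    (hinj : Function.Injective (Algebra.lsmul K K L : H →ₐ[K] Module.End K L))
    (hrank : Module.finrank K H = Module.finrank K L)
    (hfree : Module.Free (associatedOrder O K H L) (integralClosure O L)) :
    ∃ γ : integralClosure O L, IsFreeGenerator (associatedOrder O K H L) γ := by
  have := integralClosure.finite_of_isSeparable O K L
  have := integralClosure.free_of_isSeparable O K L
  have := associatedOrder.finite_of_injective (O := O) hinj
  have := associatedOrder.free_of_injective (O := O) hinj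
  have hl1 := integralClosure.isLocalizedModule_val O K L
  have hl2 := associatedOrder.isLocalizedModule_val O K H L
  have r1 : Module.finrank O (integralClosure O L) = Module.finrank K L := by
    rw [Module.finrank_eq_card_chooseBasisIndex, Module.finrank_eq_card_basis
      ((Module.Free.chooseBasis O _).ofIsLocalizedModule K O⁰
        (integralClosure O L).val.toLinearMap)]
  have r2 : Module.finrank O (associatedOrder O K H L) = Module.finrank K H := by
    rw [Module.finrank_eq_card_chooseBasisIndex, Module.finrank_eq_card_basis
      ((Module.Free.chooseBasis O _).ofIsLocalizedModule K O⁰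
        (associatedOrder O K H L).val.toLinearMap)]
  have : Module.Finite (associatedOrder O K H L) (integralClosure O L) :=
    Module.Finite.of_restrictScalars_finite O _ _
  have : Nontrivial (associatedOrder O K H L) := by
    refine Module.nontrivial_of_finrank_pos (R := O) ?_
    rw [r2, hrank]; exact Module.finrank_pos
  -- The order need not be commutative; being finite over `O` it is Noetherian, so ranks over it
  -- make sense.
  have : StrongRankCondition (associatedOrder O K H L) := by
    have : IsNoetherian O (associatedOrder O K H L) := inferInstance
    have : IsNoetherianRing (associatedOrder O K H L) := isNoetherian_of_tower O this
    infer_instance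
  let b := Module.Free.chooseBasis (associatedOrder O K H L) (integralClosure O L)
  -- Both `𝔄` and `𝒪_L` have `O`-rank `[L:K]`, so an `𝔄`-basis of `𝒪_L` has exactly one element.
  have hcard := Module.finrank_mul_finrank O (associatedOrder O K H L) (integralClosure O L)
  rw [r1, r2, hrank, Module.finrank_eq_card_basis b] at hcard
  have h1 : Fintype.card (Module.Free.ChooseBasisIndex (associatedOrder O K H L)
      (integralClosure O L)) = 1 :=
    Nat.eq_of_mul_eq_mul_left (Module.finrank_pos (R := K) (M := L)) (by rw [hcard, mul_one])
  obtain ⟨i, hi⟩ := Fintype.card_eq_one_iff.1 h1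
  let _ : Unique (Module.Free.ChooseBasisIndex (associatedOrder O K H L)
      (integralClosure O L)) := ⟨⟨i⟩, hi⟩
  refine ⟨b i, ?_⟩
  have h2 : (fun a : associatedOrder O K H L => a • b i) =
      fun a => b.equivFun.symm (fun _ => a) := by
    ext1 a
    rw [b.equivFun_symm_apply, Fintype.sum_unique]
    rfl
  rw [IsFreeGenerator, h2]
  exact b.equivFun.symm.bijective.comp (Equiv.funUnique _ _).symm.bijective

end Lattices

theorem IsFreeGenerator.free {A M : Type*} [Ring A] [AddCommGroup M] [Module A M] {m : M}
    (h : IsFreeGenerator A m) : Module.Free A M :=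
  Module.Free.of_equiv (LinearEquiv.ofBijective (LinearMap.toSpanSingleton A M m) h)

/-! ### The embedding `ι` and left translations. -/

section ProductPermutations

variable {G : Type*} [Group G] {J G' : Subgroup G}

/-- For `G = J G'`, the permutation `στ ↦ φ(σ) ψ(τ)` of `G`. -/
noncomputable def prodPerm (hc : Subgroup.IsComplement' J G') :
    Equiv.Perm J × Equiv.Perm G' →* Equiv.Perm G :=
  (Equiv.permCongrHom hc.equiv.symm).toMonoidHom.comp
    { toFun := fun p => Equiv.prodCongr p.1 p.2
      map_one' := rfl
      map_mul' := fun _ _ => rfl }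

theorem prodPerm_apply_mul (hc : Subgroup.IsComplement' J G')
    (p : Equiv.Perm J × Equiv.Perm G') (σ : J) (τ : G') :
    prodPerm hc p ((σ : G) * τ) = (p.1 σ : G) * p.2 τ := by
  have h : hc.equiv ((σ : G) * τ) = (σ, τ) := by
    rw [← Equiv.eq_symm_apply]; rfl
  have h2 : prodPerm hc p ((σ : G) * τ) =
    hc.equiv.symm (Equiv.prodCongr p.1 p.2 (hc.equiv ((σ : G) * τ))) := rfl
  rw [h2, h]
  rfl

theorem perm_ext_of_isComplement' (hc : Subgroup.IsComplement' J G') {n m : Equiv.Perm G}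
    (h : ∀ (σ : J) (τ : G'), n ((σ : G) * τ) = m ((σ : G) * τ)) : n = m := by
  ext g
  rw [← hc.equiv_fst_mul_equiv_snd g]
  exact h _ _

theorem prodPerm_injective (hc : Subgroup.IsComplement' J G') :
    Function.Injective (prodPerm hc) := by
  intro p q h
  have h1 (σ : J) (τ : G') : (p.1 σ, p.2 τ) = (q.1 σ, q.2 τ) := by
    apply hc.equiv.symm.injective
    change (p.1 σ : G) * p.2 τ = (q.1 σ : G) * q.2 τ
    rw [← prodPerm_apply_mul hc, h, prodPerm_apply_mul]
  refine Prod.ext (Equiv.ext fun σ => ?_) (Equiv.ext fun τ => ?_)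
  · exact (Prod.ext_iff.1 (h1 σ 1)).1
  · exact (Prod.ext_iff.1 (h1 1 τ)).2

theorem mem_inducedSubgroup_iff (hc : Subgroup.IsComplement' J G')
    {N₁ : Subgroup (Equiv.Perm J)} {N₂ : Subgroup (Equiv.Perm G')} {n : Equiv.Perm G} :
    n ∈ inducedSubgroup N₁ N₂ ↔ ∃ p, p.1 ∈ N₁ ∧ p.2 ∈ N₂ ∧ prodPerm hc p = n := by
  constructor
  · rintro ⟨φ, hφ, ψ, hψ, h⟩
    refine ⟨(φ, ψ), hφ, hψ, perm_ext_of_isComplement' hc fun σ τ => ?_⟩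
    rw [h, prodPerm_apply_mul]
  · rintro ⟨p, h1, h2, rfl⟩
    exact ⟨p.1, h1, p.2, h2, prodPerm_apply_mul hc p⟩

/-- For `g = st`, `g(στ) = s(tσt⁻¹) · tτ`. Hence conjugation by a left translation on `ι(φ, ψ)` is
conjugation in each factor. -/
theorem mulLeft_eq_prodPerm [J.Normal] (hc : Subgroup.IsComplement' J G') (g : G) :
    Equiv.mulLeft g = prodPerm hc (lambdaJ hc g, lambdaG' hc g) := by
  refine perm_ext_of_isComplement' hc fun σ τ => ?_
  rw [prodPerm_apply_mul]
  have h1 : (lambdaJ hc g σ : G) =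
    (hc.equiv g).1 * ((hc.equiv g).2 * σ * ((hc.equiv g).2 : G)⁻¹) := rfl
  have h2 : (lambdaG' hc g τ : G) = (hc.equiv g).2 * τ := rfl
  rw [h1, h2, Equiv.coe_mulLeft]
  nth_rewrite 1 [← hc.equiv_fst_mul_equiv_snd g]
  group

theorem prodPerm_inv_apply_one (hc : Subgroup.IsComplement' J G')
    (p : Equiv.Perm J × Equiv.Perm G') :
    (prodPerm hc p)⁻¹ 1 = ((p.1⁻¹ 1 : J) : G) * (p.2⁻¹ 1 : G') := by
  have := prodPerm_apply_mul hc p⁻¹ 1 1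
  rw [map_inv] at this
  simpa using this

end ProductPermutations

/-! ### The operators `w ⊗ η` come from the induced Hopf algebra. -/

section InducedAction

variable {K L H₁ Hb H : Type*} [Field K] [Field L] [Algebra K L]
  {J G' : Subgroup (L ≃ₐ[K] L)} [J.Normal] (hc : Subgroup.IsComplement' J G')
  {E F : IntermediateField K L}
  [Ring H₁] [HopfAlgebra K H₁] [Module H₁ E]
  [Ring Hb] [HopfAlgebra K Hb] [Module Hb F]
  [Ring H] [HopfAlgebra K H] [Module H L]
  {N₁ : Subgroup (Equiv.Perm J)} {N₂ : Subgroup (Equiv.Perm G')}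

/-- Here `τ` fixes `α`, and `στ = τ(τ⁻¹στ)` with `τ⁻¹στ ∈ J` by normality, so `στ` acts on `z` as
`τ`. -/
theorem mul_apply_mul_of_fixedField (hE : E = IntermediateField.fixedField G')
    (hF : F = IntermediateField.fixedField J)
    (σ : J) (τ : G') (α : E) (z : F) :
    ((σ : L ≃ₐ[K] L) * (τ : L ≃ₐ[K] L)) ((α : L) * z) =
      (σ : L ≃ₐ[K] L) α * (τ : L ≃ₐ[K] L) z := by
  subst hE hF
  have hα : (τ : L ≃ₐ[K] L) (α : L) = α := α.2 τ
  have hz := z.2 ⟨_, ‹J.Normal›.conj_mem _ σ.2 ((τ : L ≃ₐ[K] L)⁻¹)⟩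
  have hz' : ((τ : L ≃ₐ[K] L)⁻¹ * (σ : L ≃ₐ[K] L) * ((τ : L ≃ₐ[K] L)⁻¹)⁻¹) (z : L) = z := hz
  rw [inv_inv, mul_assoc, AlgEquiv.mul_apply] at hz'
  have h3 := congrArg (τ : L ≃ₐ[K] L) hz'
  rw [← AlgEquiv.mul_apply, mul_inv_cancel, AlgEquiv.one_apply] at h3
  rw [map_mul, AlgEquiv.mul_apply, hα, h3]

/-- The elements of `L[N₁]^G ⊗ L[N₂]^G` act on `L = EF` through elements of `L[ι(N₁ × N₂)]^G`. -/
theorem exists_smul_mul_eq [FiniteDimensional K L] (hE : E = IntermediateField.fixedField G')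
    (hF : F = IntermediateField.fixedField J)
    (hGP₁ : IsGreitherPareigis (lambdaJ hc) (fun σ : J => (σ : L ≃ₐ[K] L)) 1 N₁ H₁ E)
    (hGP₂ : IsGreitherPareigis (lambdaG' hc) (fun τ : G' => (τ : L ≃ₐ[K] L)) 1 N₂ Hb F)
    (hGP : IsGreitherPareigis (fun g : L ≃ₐ[K] L => Equiv.mulLeft g)
      (fun g : L ≃ₐ[K] L => g) 1 (inducedSubgroup N₁ N₂) H L) (w : H₁) (η : Hb) :
    ∃ h : H, ∀ (α : E) (z : F), h • ((α : L) * (z : L)) = ((w • α : E) : L) * ((η • z : F) : L) := by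
  obtain ⟨Ψ₁, -, hΨ₁, hact₁⟩ := hGP₁
  obtain ⟨Ψ₂, -, hΨ₂, hact₂⟩ := hGP₂
  obtain ⟨Ψ, -, hΨ, hact⟩ := hGP
  obtain ⟨hs₁, hg₁⟩ := (hΨ₁ _).1 ⟨w, rfl⟩
  obtain ⟨hs₂, hg₂⟩ := (hΨ₂ _).1 ⟨η, rfl⟩
  replace hact₁ := hact₁ w
  replace hact₂ := hact₂ η
  set f₁ := (Ψ₁ (1 ⊗ₜ[K] w)).coeff
  set f₂ := (Ψ₂ (1 ⊗ₜ[K] η)).coeff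
  let f₀ : Equiv.Perm J × Equiv.Perm G' →₀ L :=
    Finsupp.equivFunOnFinite.symm fun p => f₁ p.1 * f₂ p.2
  let ι : Equiv.Perm J × Equiv.Perm G' ↪ Equiv.Perm (L ≃ₐ[K] L) :=
    ⟨prodPerm hc, prodPerm_injective hc⟩
  -- Product coefficients, extended by zero outside the image of `ι`.
  let f : MonoidAlgebra L (Equiv.Perm (L ≃ₐ[K] L)) := ⟨f₀.embDomain ι⟩
  have hf_self (p) : f.coeff (prodPerm hc p) = f₁ p.1 * f₂ p.2 :=
    Finsupp.embDomain_apply_self ι f₀ p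
  have hf_notin (n) (hn : n ∉ Set.range (prodPerm hc)) : f.coeff n = 0 :=
    Finsupp.embDomain_of_notMem_range ι f₀ n hn
  obtain ⟨h, hh⟩ := (hΨ f).2 <| by
    constructor
    · intro n hn
      obtain ⟨p, rfl⟩ : n ∈ Set.range (prodPerm hc) := by
        by_contra hcon
        exact hn (hf_notin n hcon)
      rw [hf_self] at hn
      exact (mem_inducedSubgroup_iff hc).2
        ⟨p, hs₁ _ (left_ne_zero_of_mul hn), hs₂ _ (right_ne_zero_of_mul hn), rfl⟩
    · intro g n
      beta_reduce
      rw [mulLeft_eq_prodPerm hc]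
      by_cases hn : n ∈ Set.range (prodPerm hc)
      · obtain ⟨p, rfl⟩ := hn
        rw [← map_inv, ← map_mul, ← map_mul, hf_self, hf_self, map_mul]
        exact congrArg₂ _ (hg₁ g p.1) (hg₂ g p.2)
      -- The image of `ι` is stable under conjugation by translations, so both coefficients vanish.
      · rw [hf_notin n hn, hf_notin, map_zero]
        rintro ⟨p, hp⟩
        refine hn ⟨(lambdaJ hc g, lambdaG' hc g)⁻¹ * p * (lambdaJ hc g, lambdaG' hc g), ?_⟩
        rw [map_mul, map_mul, hp, map_inv]
        group
  have := Fintype.ofFinite (Equiv.Perm J)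
  have := Fintype.ofFinite (Equiv.Perm G')
  refine ⟨h, fun α z => ?_⟩
  have h1 := hact h ((α : L) * z)
  rw [hh] at h1
  have h2 := hact₁ α
  have h3 := hact₂ z
  change ((w • α : E) : L) = _ at h2
  change ((η • z : F) : L) = _ at h3
  change h • ((α : L) * z) = _ at h1
  rw [h1, h2, h3]
  change (f₀.embDomain ι).sum _ = _
  rw [Finsupp.sum_embDomain, Finsupp.sum_fintype _ _ (by simp), Finsupp.sum_fintype _ _ (by simp),
    Finsupp.sum_fintype _ _ (by simp), Fintype.sum_mul_sum, ← Fintype.sum_prod_type']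
  refine Finset.sum_congr rfl fun p _ => ?_
  change f₁ p.1 * f₂ p.2 * ((prodPerm hc p)⁻¹ 1) ((α : L) * z) = f₁ p.1 * _ * (f₂ p.2 * _)
  -- Since `n⁻¹(1) = φ⁻¹(1) ψ⁻¹(1)` for `n = ι(φ, ψ)`, each term of the double sum factors.
  rw [prodPerm_inv_apply_one, mul_apply_mul_of_fixedField hE hF]
  exact mul_mul_mul_comm _ _ _ _

end InducedAction

/-! ### Linear disjointness of `E` and `F`. -/

section LinearDisjointness

variable {K L : Type*} [Field K] [Field L] [Algebra K L] [FiniteDimensional K L] [IsGalois K L]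
  {J G' : Subgroup (L ≃ₐ[K] L)}

/-- The compositum is fixed exactly by `G' ∩ J = 1`. -/
theorem fixedField_sup_eq_top_of_isComplement' (hc : Subgroup.IsComplement' J G') :
    IntermediateField.fixedField G' ⊔ IntermediateField.fixedField J = ⊤ := by
  have h : (IntermediateField.fixedField G' ⊔ IntermediateField.fixedField J).fixingSubgroup
      = ⊥ := by
    rw [IntermediateField.fixingSubgroup_sup, IntermediateField.fixingSubgroup_fixedField,
      IntermediateField.fixingSubgroup_fixedField, inf_comm]
    exact hc.disjoint.eq_bot
  rw [← IsGalois.fixedField_fixingSubgroup (IntermediateField.fixedField G' ⊔ _), h,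
    IntermediateField.fixedField_bot]

theorem finrank_fixedField_mul_finrank_fixedField (hc : Subgroup.IsComplement' J G') :
    Module.finrank K (IntermediateField.fixedField G') *
      Module.finrank K (IntermediateField.fixedField J) = Module.finrank K L := by
  have h1 := Module.finrank_mul_finrank K (IntermediateField.fixedField G') L
  have h2 := Module.finrank_mul_finrank K (IntermediateField.fixedField J) L
  rw [IntermediateField.finrank_fixedField_eq_card] at h1 h2
  have h3 : Nat.card J * Nat.card G' = Module.finrank K L := by
    rw [← IsGalois.card_aut_eq_finrank K L]; exact hc.card_mul_card
  have hJ : 0 < Nat.card J := Nat.card_pos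
  have hG : 0 < Nat.card G' := Nat.card_pos
  have e1 : Module.finrank K (IntermediateField.fixedField G') = Nat.card J :=
    Nat.eq_of_mul_eq_mul_right hG (h1.trans h3.symm)
  have e2 : Module.finrank K (IntermediateField.fixedField J) = Nat.card G' :=
    Nat.eq_of_mul_eq_mul_right hJ (h2.trans (h3.symm.trans (mul_comm _ _)))
  rw [e1, e2, h3]

theorem productMap_fixedField_bijective (hc : Subgroup.IsComplement' J G')
    {E F : IntermediateField K L} (hE : E = IntermediateField.fixedField G')
    (hF : F = IntermediateField.fixedField J) :
    Function.Bijective (Algebra.TensorProduct.productMap E.val F.val) := by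
  have hrank : Module.finrank K E * Module.finrank K F = Module.finrank K L := by
    subst hE hF; exact finrank_fixedField_mul_finrank_fixedField hc
  have hdis : E.LinearDisjoint F := by
    refine IntermediateField.LinearDisjoint.of_finrank_sup ?_
    rw [hrank, hE, hF, fixedField_sup_eq_top_of_isComplement' hc, IntermediateField.finrank_top']
  have hinj : Function.Injective (Algebra.TensorProduct.productMap E.val F.val) :=
    Subalgebra.linearDisjoint_iff_injective.1 (IntermediateField.linearDisjoint_iff'.1 hdis)
  refine ⟨hinj, ?_⟩
  exact (LinearMap.injective_iff_surjective_of_finrank_eq_finrank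
    (f := (Algebra.TensorProduct.productMap E.val F.val).toLinearMap)
    (by rw [Module.finrank_tensorProduct, hrank])).1 hinj

end LinearDisjointness

/-! ### The isomorphism `H₁ ⊗ Hb ≃ H`. -/

section Identification

variable {K L H₁ Hb H : Type*} [Field K] [Field L] [Algebra K L] [FiniteDimensional K L]
  {E F : IntermediateField K L}
  [Ring H₁] [Algebra K H₁] [Module H₁ E] [IsScalarTower K H₁ E]
  [Ring Hb] [Algebra K Hb] [Module Hb F] [IsScalarTower K Hb F]
  [Ring H] [Algebra K H] [Module H L] [IsScalarTower K H L]

/-- If the tensor products `w ⊗ η` act on `L = E ⊗ F` through elements of `H`, where `H` acts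
faithfully, then `H₁ ⊗ Hb` is identified with `H` as soon as the dimensions agree. -/
theorem exists_tensorProduct_algEquiv
    (hμ : Function.Bijective (Algebra.TensorProduct.productMap E.val F.val))
    (h₁ : Function.Injective (Algebra.lsmul K K E : H₁ →ₐ[K] Module.End K E))
    (hb : Function.Injective (Algebra.lsmul K K F : Hb →ₐ[K] Module.End K F))
    (hh : Function.Injective (Algebra.lsmul K K L : H →ₐ[K] Module.End K L))
    (hrank : Module.finrank K H₁ * Module.finrank K Hb = Module.finrank K H)
    (hex : ∀ (w : H₁) (η : Hb), ∃ h : H, ∀ (α : E) (z : F),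
      h • ((α : L) * (z : L)) = ((w • α : E) : L) * ((η • z : F) : L)) :
    ∃ φ : (H₁ ⊗[K] Hb) ≃ₐ[K] H, ∀ (w : H₁) (η : Hb) (α : E) (z : F),
      φ (w ⊗ₜ[K] η) • ((α : L) * (z : L)) = ((w • α : E) : L) * ((η • z : F) : L) := by
  have : FiniteDimensional K H₁ := Module.Finite.of_injective
    (Algebra.lsmul K K E : H₁ →ₐ[K] Module.End K E).toLinearMap h₁
  have : FiniteDimensional K Hb := Module.Finite.of_injective
    (Algebra.lsmul K K F : Hb →ₐ[K] Module.End K F).toLinearMap hb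
  have : FiniteDimensional K H := Module.Finite.of_injective
    (Algebra.lsmul K K L : H →ₐ[K] Module.End K L).toLinearMap hh
  let μ : (E ⊗[K] F) ≃ₐ[K] L := AlgEquiv.ofBijective _ hμ
  -- The action of `H₁ ⊗ Hb` on `E ⊗ F`, transported to `L`.
  let ρ : (H₁ ⊗[K] Hb) →ₐ[K] Module.End K L :=
    (μ.toLinearEquiv.conjAlgEquiv K).toAlgHom.comp
      ((Module.endTensorEndAlgHom (R := K) (S := K) (A := K)).comp
        (Algebra.TensorProduct.map (Algebra.lsmul K K E) (Algebra.lsmul K K F)))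
  have hμ_tmul (α : E) (z : F) : μ (α ⊗ₜ z) = (α : L) * z :=
    Algebra.TensorProduct.productMap_apply_tmul _ _ _ _
  have hρ_tmul (w : H₁) (η : Hb) (α : E) (z : F) :
      ρ (w ⊗ₜ η) ((α : L) * z) = ((w • α : E) : L) * ((η • z : F) : L) := by
    rw [← hμ_tmul, ← hμ_tmul]
    simp [ρ]
    rfl
  have hρ : Function.Injective ρ := by
    refine (μ.toLinearEquiv.conjAlgEquiv K).injective.comp ?_
    -- In finite dimension `End E ⊗ End F → End (E ⊗ F)` is an isomorphism.
    have e1 : Function.Injective (Module.endTensorEndAlgHom (R := K) (S := K) (A := K) :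
        Module.End K E ⊗[K] Module.End K F →ₐ[K] _) := by
      have := (homTensorHomEquiv K E F E F).injective
      convert this using 1
      ext1 t
      induction t with
      | zero => simp
      | add a b ha hb => simp only [map_add, ha, hb]
      | tmul f g => simp [homTensorHomEquiv_apply]; rfl
    exact e1.comp (TensorProduct.map_injective_of_flat_flat
      (Algebra.lsmul K K E : H₁ →ₐ[K] Module.End K E).toLinearMap
      (Algebra.lsmul K K F : Hb →ₐ[K] Module.End K F).toLinearMap h₁ hb)
  have hrange (t : H₁ ⊗[K] Hb) :
      ρ t ∈ (Algebra.lsmul K K L : H →ₐ[K] Module.End K L).range := by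
    induction t with
    | zero => simp
    | add a b ha hb => rw [map_add]; exact add_mem ha hb
    | tmul w η =>
      obtain ⟨h, hhw⟩ := hex w η
      refine ⟨h, LinearMap.ext fun x => ?_⟩
      obtain ⟨t, rfl⟩ := μ.surjective x
      induction t with
      | zero => simp
      | add a b ha hb => rw [map_add, map_add, map_add, ha, hb]
      | tmul α z => rw [hμ_tmul, hρ_tmul, ← hhw]; rfl
  -- As `H` embeds in `End_K(L)` and contains the range of `ρ`, `ρ` lifts to an algebra map into
  -- `H`.
  let e := AlgEquiv.ofInjective (Algebra.lsmul K K L : H →ₐ[K] Module.End K L) hh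
  let φ₀ : (H₁ ⊗[K] Hb) →ₐ[K] H := e.symm.toAlgHom.comp (ρ.codRestrict _ hrange)
  have hφ₀ (t) : Algebra.lsmul K K L (φ₀ t) = ρ t :=
    congrArg Subtype.val (e.apply_symm_apply (ρ.codRestrict _ hrange t))
  have hinj : Function.Injective φ₀ := fun a b hab => hρ (by rw [← hφ₀, hab, hφ₀])
  have hsurj : Function.Surjective φ₀ :=
    (LinearMap.injective_iff_surjective_of_finrank_eq_finrank (f := φ₀.toLinearMap)
      (by rw [Module.finrank_tensorProduct, hrank])).1 hinj
  refine ⟨AlgEquiv.ofBijective φ₀ ⟨hinj, hsurj⟩, fun w η α z => ?_⟩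
  rw [← hρ_tmul, ← hφ₀]
  rfl

end Identification

/-! ### Associated orders and free generators under arithmetic disjointness. -/

section TensorProductOfOrders

open nonZeroDivisors

variable {O K L H₁ Hb H : Type*} [CommRing O] [Field K] [Algebra O K] [Field L] [Algebra K L]
  [Algebra O L] [IsScalarTower O K L] {E F : IntermediateField K L}

/-- Under arithmetic disjointness, an element of `L = E ⊗ F` is integral only if its coordinates in
`F` with respect to an `O`-basis of `𝒪_E` are. -/
theorem ArithmeticallyDisjoint.coord_mem_integralClosure
    [IsDomain O] [IsFractionRing O K] [FiniteDimensional K L]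
    (hdisj : ArithmeticallyDisjoint O E F) (htop : E ⊔ F = ⊤)
    (hμ : Function.Injective (Algebra.TensorProduct.productMap E.val F.val))
    {ι : Type*} (e : Module.Basis ι O (integralClosure O E)) (f : ι →₀ F)
    (hf : IsIntegral O (f.sum fun i z => ((e i : E) : L) * (z : L))) (i : ι) :
    f i ∈ integralClosure O F := by
  classical
  have hloc := integralClosure.isLocalizedModule_val O K E
  let eK := e.ofIsLocalizedModule K O⁰ (integralClosure O E).val.toLinearMap
  have heK (i) : eK i = (e i : E) :=
    e.ofIsLocalizedModule_apply K O⁰ (integralClosure O E).val.toLinearMap i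
  obtain ⟨t, ht⟩ := (hdisj.2 _).2 ⟨htop ▸ IntermediateField.mem_top, hf⟩
  obtain ⟨g, rfl⟩ := TensorProduct.eq_repr_basis_left e t
  let g' : ι →₀ F := g.mapRange Subtype.val rfl
  -- Coordinates in `E ⊗ F` along a `K`-basis of `E` are unique, and those of `t` lie in `𝒪_F`.
  suffices h : f = g' by rw [h]; exact (g i).2
  refine (TensorProduct.equivFinsuppOfBasisLeft eK).symm.injective (hμ ?_)
  rw [TensorProduct.equivFinsuppOfBasisLeft_symm_apply,
    TensorProduct.equivFinsuppOfBasisLeft_symm_apply, Finsupp.sum_mapRange_index (by simp),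
    map_finsuppSum, map_finsuppSum]
  refine Eq.trans ?_ (ht.symm.trans ?_)
  · simp [heK]
  · change (Algebra.TensorProduct.productMap (integersVal O E) (integersVal O F)) _ = _
    rw [map_finsuppSum]
    simp [heK, integersVal]

variable [Ring H₁] [Algebra K H₁] [Algebra O H₁] [IsScalarTower O K H₁]
  [Module H₁ E] [IsScalarTower K H₁ E]
  [Ring Hb] [Algebra K Hb] [Algebra O Hb] [IsScalarTower O K Hb]
  [Module Hb F] [IsScalarTower K Hb F]
  [Ring H] [Algebra K H] [Algebra O H] [IsScalarTower O K H]

variable (O E F) in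
/-- The canonical map `𝔄_{H₁} ⊗ 𝔄_{Hb} → H₁ ⊗ Hb ≃ H`. -/
noncomputable def associatedOrderTensorMap (φ : (H₁ ⊗[K] Hb) ≃ₐ[K] H) :
    (associatedOrder O K H₁ E ⊗[O] associatedOrder O K Hb F) →ₐ[O] H :=
  Algebra.TensorProduct.lift
    ((φ.toAlgHom.restrictScalars O).comp
      (((Algebra.TensorProduct.includeLeft : H₁ →ₐ[K] H₁ ⊗[K] Hb).restrictScalars O).comp
        (associatedOrder O K H₁ E).val))
    ((φ.toAlgHom.restrictScalars O).comp
      (((Algebra.TensorProduct.includeRight : Hb →ₐ[K] H₁ ⊗[K] Hb).restrictScalars O).comp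
        (associatedOrder O K Hb F).val))
    (fun x y => by
      refine Commute.map (f := φ.toAlgHom) ?_
      simp [Commute, SemiconjBy])

@[simp]
theorem associatedOrderTensorMap_tmul (φ : (H₁ ⊗[K] Hb) ≃ₐ[K] H)
    (a : associatedOrder O K H₁ E) (b : associatedOrder O K Hb F) :
    associatedOrderTensorMap O E F φ (a ⊗ₜ b) = φ ((a : H₁) ⊗ₜ[K] (b : Hb)) := by
  refine (Algebra.TensorProduct.lift_tmul _ _ _ a b).trans ?_
  change φ ((a : H₁) ⊗ₜ 1) * φ (1 ⊗ₜ (b : Hb)) = _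
  rw [← map_mul]
  simp

/-- An `O`-basis of `𝔄_{Hb}` is a `K`-basis of `Hb`, so the coordinates in `𝔄_{H₁}` can be compared
inside `H₁`. -/
theorem associatedOrderTensorMap_injective [IsDomain O] [IsPrincipalIdealRing O]
    [IsFractionRing O K] [FiniteDimensional K L] [Algebra.IsSeparable K L] (φ : (H₁ ⊗[K] Hb) ≃ₐ[K] H)
    (hb : Function.Injective (Algebra.lsmul K K F : Hb →ₐ[K] Module.End K F)) :
    Function.Injective (associatedOrderTensorMap O E F φ) := by
  have := associatedOrder.free_of_injective (O := O) hb
  have hloc := associatedOrder.isLocalizedModule_val O K Hb F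
  let b := Module.Free.chooseBasis O (associatedOrder O K Hb F)
  let bK := b.ofIsLocalizedModule K O⁰ (associatedOrder O K Hb F).val.toLinearMap
  have hbK (j) : bK j = (b j : Hb) :=
    b.ofIsLocalizedModule_apply K O⁰ (associatedOrder O K Hb F).val.toLinearMap j
  rw [injective_iff_map_eq_zero]
  intro t ht
  obtain ⟨a, rfl⟩ := TensorProduct.eq_repr_basis_right b t
  rw [map_finsuppSum] at ht
  simp only [associatedOrderTensorMap_tmul] at ht
  rw [← map_finsuppSum, map_eq_zero_iff _ φ.injective] at ht
  have h0 := TensorProduct.sum_tmul_basis_right_eq_zero bK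
    (a.mapRange (Subtype.val : associatedOrder O K H₁ E → H₁) rfl)
    (by rw [Finsupp.sum_mapRange_index (by simp)]; simpa only [hbK] using ht)
  have ha : a = 0 := Finsupp.mapRange_injective _ rfl Subtype.val_injective
    (h0.trans (Finsupp.mapRange_zero (hf := rfl)).symm)
  rw [ha, Finsupp.sum_zero_index]

variable [Module H L] [IsScalarTower K H L]

/-- By disjointness `𝒪_L` is spanned by products `αz`, on which `a ⊗ b` acts factorwise. -/
theorem associatedOrderTensorMap_mem (φ : (H₁ ⊗[K] Hb) ≃ₐ[K] H)
    (hφ : ∀ (w : H₁) (η : Hb) (α : E) (z : F),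
      φ (w ⊗ₜ[K] η) • ((α : L) * (z : L)) = ((w • α : E) : L) * ((η • z : F) : L))
    (hdisj : ArithmeticallyDisjoint O E F) (htop : E ⊔ F = ⊤)
    (t : associatedOrder O K H₁ E ⊗[O] associatedOrder O K Hb F) :
    associatedOrderTensorMap O E F φ t ∈ associatedOrder O K H L := by
  induction t with
  | zero => simp
  | add s t hs ht => rw [map_add]; exact add_mem hs ht
  | tmul a b =>
    rw [associatedOrderTensorMap_tmul]
    intro x hx
    obtain ⟨s, rfl⟩ := (hdisj.2 x).2 ⟨htop ▸ IntermediateField.mem_top, hx⟩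
    change _ • (Algebra.TensorProduct.productMap (integersVal O E) (integersVal O F)) s ∈ _
    induction s with
    | zero => simp
    | add s t hs ht =>
      rw [map_add, smul_add]
      exact add_mem (hs ((hdisj.2 _).1 ⟨s, rfl⟩).2) (ht ((hdisj.2 _).1 ⟨t, rfl⟩).2)
    | tmul α z =>
      rw [Algebra.TensorProduct.productMap_apply_tmul]
      change φ _ • (((α : E) : L) * ((z : F) : L)) ∈ _
      rw [hφ]
      exact (integersMul (a • α) (b • z)).2

/-- The product of free generators of `𝒪_E` and `𝒪_F` is a free generator of `𝒪_L`. -/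
theorem isFreeGenerator_integersMul (φ : (H₁ ⊗[K] Hb) ≃ₐ[K] H)
    (hφ : ∀ (w : H₁) (η : Hb) (α : E) (z : F),
      φ (w ⊗ₜ[K] η) • ((α : L) * (z : L)) = ((w • α : E) : L) * ((η • z : F) : L))
    (hdisj : ArithmeticallyDisjoint O E F) (htop : E ⊔ F = ⊤)
    (Θ : (associatedOrder O K H₁ E ⊗[O] associatedOrder O K Hb F) ≃ₐ[O] associatedOrder O K H L)
    (hΘ : ∀ (a : associatedOrder O K H₁ E) (b : associatedOrder O K Hb F),
      (Θ (a ⊗ₜ[O] b) : H) = φ ((a : H₁) ⊗ₜ[K] (b : Hb)))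
    {γ : integralClosure O E} {δ : integralClosure O F}
    (hγ : IsFreeGenerator (associatedOrder O K H₁ E) γ)
    (hδ : IsFreeGenerator (associatedOrder O K Hb F) δ) :
    IsFreeGenerator (associatedOrder O K H L) (integersMul γ δ) := by
  let m := Algebra.TensorProduct.productMap (integersVal O E) (integersVal O F)
  let g₁ := LinearEquiv.ofBijective
    ((LinearMap.toSpanSingleton (associatedOrder O K H₁ E) _ γ).restrictScalars O) hγ
  let g₂ := LinearEquiv.ofBijective
    ((LinearMap.toSpanSingleton (associatedOrder O K Hb F) _ δ).restrictScalars O) hδ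
  have key (t) : ((Θ t • integersMul γ δ : integralClosure O L) : L) =
      m (TensorProduct.congr g₁ g₂ t) := by
    induction t with
    | zero =>
      rw [map_zero Θ, zero_smul, (TensorProduct.congr g₁ g₂).map_zero]
      exact (m.toLinearMap.map_zero).symm
    | add s t hs ht =>
      rw [map_add Θ, add_smul, (TensorProduct.congr g₁ g₂).map_add]
      exact (congrArg₂ (· + ·) hs ht).trans (m.toLinearMap.map_add _ _).symm
    | tmul a b =>
      change (Θ (a ⊗ₜ b) : H) • (((γ : E) : L) * ((δ : F) : L)) = _
      rw [hΘ, hφ, TensorProduct.congr_tmul, Algebra.TensorProduct.productMap_apply_tmul]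
      rfl
  rw [IsFreeGenerator, ← Function.Bijective.of_comp_iff _ Θ.bijective]
  constructor
  · intro s t hst
    have h := congrArg Subtype.val hst
    simp only [Function.comp_apply] at h
    rw [key, key] at h
    exact (TensorProduct.congr g₁ g₂).injective (hdisj.1 h)
  · intro x
    obtain ⟨s, hs⟩ := (hdisj.2 x).2 ⟨htop ▸ IntermediateField.mem_top, x.2⟩
    refine ⟨(TensorProduct.congr g₁ g₂).symm s, Subtype.ext ?_⟩
    rw [Function.comp_apply, key, LinearEquiv.apply_symm_apply]
    exact hs

variable [IsDomain O] [IsPrincipalIdealRing O] [IsFractionRing O K] [FiniteDimensional K L]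
  [Algebra.IsSeparable K L]

/-- An element of `H` preserving `𝒪_L = 𝒪_E ⊗ 𝒪_F` comes from `𝔄_{H₁} ⊗ 𝔄_{Hb}`. -/
theorem mem_range_associatedOrderTensorMap (φ : (H₁ ⊗[K] Hb) ≃ₐ[K] H)
    (hφ : ∀ (w : H₁) (η : Hb) (α : E) (z : F),
      φ (w ⊗ₜ[K] η) • ((α : L) * (z : L)) = ((w • α : E) : L) * ((η • z : F) : L))
    (hb : Function.Injective (Algebra.lsmul K K F : Hb →ₐ[K] Module.End K F))
    (hdisj : ArithmeticallyDisjoint O E F) (htop : E ⊔ F = ⊤)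
    (hμ : Function.Injective (Algebra.TensorProduct.productMap E.val F.val))
    {h : H} (hh : h ∈ associatedOrder O K H L) :
    h ∈ (associatedOrderTensorMap O E F φ).range := by
  have := associatedOrder.free_of_injective (O := O) hb
  have hloc := associatedOrder.isLocalizedModule_val O K Hb F
  have := associatedOrder.finite_of_injective (O := O) hb
  have := integralClosure.finite_of_isSeparable O K E
  have := integralClosure.free_of_isSeparable O K E
  have hlocE := integralClosure.isLocalizedModule_val O K E
  let b := Module.Free.chooseBasis O (associatedOrder O K Hb F)
  let bK := b.ofIsLocalizedModule K O⁰ (associatedOrder O K Hb F).val.toLinearMap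
  have hbK (j) : bK j = (b j : Hb) :=
    b.ofIsLocalizedModule_apply K O⁰ (associatedOrder O K Hb F).val.toLinearMap j
  let e := Module.Free.chooseBasis O (integralClosure O E)
  let eK := e.ofIsLocalizedModule K O⁰ (integralClosure O E).val.toLinearMap
  have heK (i) : eK i = (e i : E) :=
    e.ofIsLocalizedModule_apply K O⁰ (integralClosure O E).val.toLinearMap i
  obtain ⟨t, rfl⟩ := φ.surjective h
  obtain ⟨u, rfl⟩ := TensorProduct.eq_repr_basis_right bK t
  rw [Finsupp.sum_fintype _ _ (by simp)] at hh ⊢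
  suffices hu : ∀ j, u j ∈ associatedOrder O K H₁ E by
    refine ⟨∑ j, (⟨u j, hu j⟩ : associatedOrder O K H₁ E) ⊗ₜ b j, ?_⟩
    change associatedOrderTensorMap O E F φ _ = _
    rw [map_sum, map_sum]
    simp only [associatedOrderTensorMap_tmul, hbK]
  intro j x hx
  -- the coordinates of `∑ⱼ (uⱼ • x) ⊗ bⱼ ∈ E ⊗ Hb` along the basis of `𝒪_E` lie in `𝔄_{Hb}`
  let v (i) : Hb := ∑ j, eK.repr (u j • x) i • bK j
  have hv (i) : v i ∈ associatedOrder O K Hb F := by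
    intro y hy
    have key := hh ((x : L) * (y : L)) (integersMul ⟨x, hx⟩ ⟨y, hy⟩).2
    have hcoord := hdisj.coord_mem_integralClosure htop hμ e
      (Finsupp.equivFunOnFinite.symm fun i => v i • y) ?_ i
    · exact hcoord
    -- Expanding each `uⱼ • x` along `eᵢ` and exchanging sums gives `h • (xy) = ∑ᵢ eᵢ (vᵢ • y)`.
    · convert show IsIntegral O _ from key using 2
      rw [Finsupp.sum_fintype _ _ (by simp), map_sum, Finset.sum_smul]
      simp only [hφ, Finsupp.equivFunOnFinite_symm_apply_apply, v, Finset.sum_smul, smul_assoc]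
      push_cast
      simp only [Finset.mul_sum]
      rw [Finset.sum_comm]
      refine Finset.sum_congr rfl fun j _ => ?_
      have hx := congrArg (fun a : E => (a : L)) (eK.sum_repr (u j • x))
      simp only [IntermediateField.coe_sum, IntermediateField.coe_smul, heK] at hx
      rw [← hx, Finset.sum_mul]
      refine Finset.sum_congr rfl fun i _ => ?_
      rw [mul_smul_comm, smul_mul_assoc]
  -- The coordinates of `vᵢ` along the `O`-basis of `𝔄_{Hb}` lie in `O` and agree with those along
  -- the `K`-basis `bK`.
  have hc (i) : ∃ c : O, eK.repr (u j • x) i = algebraMap O K c := by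
    refine ⟨b.repr ⟨v i, hv i⟩ j, ?_⟩
    have h1 := congrArg (Subtype.val : associatedOrder O K Hb F → Hb) (b.sum_repr ⟨v i, hv i⟩)
    have h2 : ∑ j, algebraMap O K (b.repr ⟨v i, hv i⟩ j) • bK j = v i := by
      refine Eq.trans ?_ h1
      simp only [hbK, AddSubmonoidClass.coe_finsetSum, algebraMap_smul, Subalgebra.coe_smul]
    have h3 := congrArg (fun w => bK.repr w j) h2
    simpa only [v, bK.repr_sum_self] using h3.symm
  choose c hc using hc
  rw [← eK.sum_repr (u j • x)]
  refine sum_mem fun i _ => ?_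
  rw [hc, algebraMap_smul, heK]
  exact Subalgebra.smul_mem _ (e i).2 _

/-- The associated order of `H = H₁ ⊗ Hb` is `𝔄_{H₁} ⊗ 𝔄_{Hb}`. -/
theorem exists_associatedOrder_algEquiv (φ : (H₁ ⊗[K] Hb) ≃ₐ[K] H)
    (hφ : ∀ (w : H₁) (η : Hb) (α : E) (z : F),
      φ (w ⊗ₜ[K] η) • ((α : L) * (z : L)) = ((w • α : E) : L) * ((η • z : F) : L))
    (hb : Function.Injective (Algebra.lsmul K K F : Hb →ₐ[K] Module.End K F))
    (hdisj : ArithmeticallyDisjoint O E F) (htop : E ⊔ F = ⊤)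
    (hμ : Function.Injective (Algebra.TensorProduct.productMap E.val F.val)) :
    ∃ Θ : (associatedOrder O K H₁ E ⊗[O] associatedOrder O K Hb F) ≃ₐ[O]
        associatedOrder O K H L,
      ∀ (a : associatedOrder O K H₁ E) (b : associatedOrder O K Hb F),
        (Θ (a ⊗ₜ[O] b) : H) = φ ((a : H₁) ⊗ₜ[K] (b : Hb)) := by
  refine ⟨AlgEquiv.ofBijective ((associatedOrderTensorMap O E F φ).codRestrict _
    (associatedOrderTensorMap_mem φ hφ hdisj htop)) ⟨?_, fun h => ?_⟩, fun a b => ?_⟩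
  · intro s t hst
    exact associatedOrderTensorMap_injective φ hb (congrArg Subtype.val hst)
  · obtain ⟨t, ht⟩ := mem_range_associatedOrderTensorMap φ hφ hb hdisj htop hμ h.2
    exact ⟨t, Subtype.ext ht⟩
  · exact associatedOrderTensorMap_tmul φ a b

end TensorProductOfOrders

theorem theorem1p5
    {O K L H₁ Hb H : Type*}
    [CommRing O] [IsDomain O] [IsPrincipalIdealRing O]
    [Field K] [Algebra O K] [IsFractionRing O K]
    [Field L] [Algebra K L] [FiniteDimensional K L] [IsGalois K L]
    [Algebra O L] [IsScalarTower O K L]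
    -- `G = Gal(L/K) = J ⋊ G'`, `E = L^{G'}`, `F = L^J`
    (J G' : Subgroup (L ≃ₐ[K] L)) [J.Normal] (hc : Subgroup.IsComplement' J G')
    (E F : IntermediateField K L)
    (hE : E = IntermediateField.fixedField G') (hF : F = IntermediateField.fixedField J)
    -- the Hopf Galois structures of `E/K`, `F/K` and `L/K`
    [Ring H₁] [HopfAlgebra K H₁] [Algebra O H₁] [IsScalarTower O K H₁]
    [Module H₁ E] [IsScalarTower K H₁ E]
    [Ring Hb] [HopfAlgebra K Hb] [Algebra O Hb] [IsScalarTower O K Hb]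
    [Module Hb F] [IsScalarTower K Hb F]
    [Ring H] [HopfAlgebra K H] [Algebra O H] [IsScalarTower O K H]
    [Module H L] [IsScalarTower K H L]
    (hH₁ : IsHopfGalois K H₁ E) (hHb : IsHopfGalois K Hb F) (hH : IsHopfGalois K H L)
    -- the structure of `L/K` is induced from those of `E/K` and `F/K`
    (N₁ : Subgroup (Equiv.Perm J)) (N₂ : Subgroup (Equiv.Perm G'))
    (hN₁ : IsRegularPermGroup N₁) (hN₁' : IsNormalizedBy (lambdaJ hc) N₁)
    (hN₂ : IsRegularPermGroup N₂) (hN₂' : IsNormalizedBy (lambdaG' hc) N₂)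
    (hGP₁ : IsGreitherPareigis (lambdaJ hc) (fun σ : J => (σ : L ≃ₐ[K] L)) 1 N₁ H₁ E)
    (hGP₂ : IsGreitherPareigis (lambdaG' hc) (fun τ : G' => (τ : L ≃ₐ[K] L)) 1 N₂ Hb F)
    (hGP : IsGreitherPareigis (fun g : L ≃ₐ[K] L => Equiv.mulLeft g)
      (fun g : L ≃ₐ[K] L => g) 1 (inducedSubgroup N₁ N₂) H L)
    (hdisj : ArithmeticallyDisjoint O E F) :
    -- the identification `H = H₁ ⊗ Hb`
    ∃ φ : (H₁ ⊗[K] Hb) ≃ₐ[K] H,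
      (∀ (w : H₁) (η : Hb) (α : E) (z : F),
        φ (w ⊗ₜ[K] η) • ((α : L) * (z : L)) = ((w • α : E) : L) * ((η • z : F) : L)) ∧
      -- the associated order of `H` is the tensor product of those of `H₁` and `Hb`
      (∃ Θ : (associatedOrder O K H₁ E ⊗[O] associatedOrder O K Hb F) ≃ₐ[O]
          associatedOrder O K H L,
        ∀ (a : associatedOrder O K H₁ E) (b : associatedOrder O K Hb F),
          (Θ (a ⊗ₜ[O] b) : H) = φ ((a : H₁) ⊗ₜ[K] (b : Hb))) ∧
      -- freeness
      (Module.Free (associatedOrder O K H₁ E) (integralClosure O E) →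
        Module.Free (associatedOrder O K Hb F) (integralClosure O F) →
        Module.Free (associatedOrder O K H L) (integralClosure O L)) ∧
      ∀ (γ : integralClosure O E) (δ : integralClosure O F),
        IsFreeGenerator (associatedOrder O K H₁ E) γ →
        IsFreeGenerator (associatedOrder O K Hb F) δ →
        IsFreeGenerator (associatedOrder O K H L) (integersMul γ δ) := by
  have htop : E ⊔ F = ⊤ := by rw [hE, hF, fixedField_sup_eq_top_of_isComplement' hc]
  have hμ := productMap_fixedField_bijective hc hE hF
  obtain ⟨φ, hφ⟩ := exists_tensorProduct_algEquiv hμ hH₁.lsmul_injective hHb.lsmul_injective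
    hH.lsmul_injective
    (by
      rw [hH₁.finrank_eq, hHb.finrank_eq, hH.finrank_eq]
      subst hE hF
      exact finrank_fixedField_mul_finrank_fixedField hc)
    (exists_smul_mul_eq hc hE hF hGP₁ hGP₂ hGP)
  obtain ⟨Θ, hΘ⟩ := exists_associatedOrder_algEquiv φ hφ hHb.lsmul_injective hdisj htop hμ.1
  have hgen (γ : integralClosure O E) (δ : integralClosure O F)
      (hγ : IsFreeGenerator (associatedOrder O K H₁ E) γ)
      (hδ : IsFreeGenerator (associatedOrder O K Hb F) δ) :
      IsFreeGenerator (associatedOrder O K H L) (integersMul γ δ) :=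
    isFreeGenerator_integersMul φ hφ hdisj htop Θ hΘ hγ hδ
  refine ⟨φ, hφ, ⟨Θ, hΘ⟩, fun h₁ h₂ => ?_, hgen⟩
  obtain ⟨γ, hγ⟩ := associatedOrder.exists_isFreeGenerator O K H₁ E hH₁.lsmul_injective
    hH₁.finrank_eq h₁
  obtain ⟨δ, hδ⟩ := associatedOrder.exists_isFreeGenerator O K Hb F hHb.lsmul_injective
    hHb.finrank_eq h₂
  exact (hgen γ δ hγ hδ).free
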